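/- **Setting.** Let $M\subset\mathbb R^n$ be a compact connected domain with smooth boundary, let $\Gamma\subset\partial M$ be (relatively) open, let $\Omega\subset M$ and $r_0>0$. For a smooth strictly positive function $c$ on $M$ let $g=c^{-2}dx^2$ be the associated isotropic Riemannian metric, $d_g$ the Riemannian distance of $(M,g)$, $\nu$ the inward pointing $g$-unit normal on $\partial M$, and for $y\in\Gamma$ let $s\mapsto\gamma(s;y,\nu)$ be the $g$-geodesic with initial point $y$ and initial velocity $\nu$, considered as long as it stays in $M$. Let $$\sigma_\Gamma(y)=\sup\{s>0:\ \gamma(\cdot;y,\nu)\text{ stays in }M\text{ on }[0,s]\text{ and } d_g(\gamma(s;y,\nu),\Gamma)=s\},$$ and define the semi-geodesic coordinate map $\Phi_g(y,s)=\gamma(s;y,\nu)$ for $y\in\Gamma$, $0\le s<\sigma_\Gamma(y)$. Let $H_c\phi=\phi\circ\Phi_g$ for $\phi\in C^\infty(M)$ with $\Delta\phi=0$ ($\Delta$ the Euclidean Laplacian), and put $$\|H_{\tilde c}-H_c\|_{C^1(M)\to C^1(\Gamma\times[0,r_0))}=\sup\{\|H_{\tilde c}\phi-H_c\phi\|_{C^1(\Gamma\times[0,r_0))}:\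 \phi\in C^\infty(M),\ \Delta\phi=0,\ \|\phi\|_{C^1(M)}\le1\}.$$ **Theorem.** Let $\mathcal G$ be a family of smooth isotropic metrics $\tilde g=\tilde c^{-2}dx^2$ on $M$, $\tilde c>0$, such that for every $\tilde g\in\mathcal G$ the map $\Phi_{\tilde g}$ is defined on $\Gamma\times[0,r_0)$ and $$\overline\Omega\subset\Phi_{\tilde g}(\Gamma\times[0,r_0)).$$ Let $c^{-2}dx^2\in\mathcal G$. Then there are $\epsilon>0$ and $C>0$ such that for every $\tilde c^{-2}dx^2\in\mathcal G$ with $\|\tilde c-c\|_{C^2(M)}\le\epsilon$, $$\|\tilde c^2-c^2\|_{C(\Omega)}\le C\,\|H_{\tilde c}-H_c\|_{C^1(M)\to C^1(\Gamma\times[0,r_0))}.$$ -/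

import Mathlib

open Set
open scoped ContDiff ENNReal

noncomputable section

namespace SemiGeodesic

/-! ### Compact domains with smooth boundary -/

/-- `ρ` is a smooth defining function on the open set `U ∋ p` of the set `M` near its boundary
point `p`: it has non-zero differential at `p` and is non-negative exactly on `M`. -/
structure IsDefiningFunctionAt {n : ℕ} (M : Set (EuclideanSpace ℝ (Fin n)))
    (p : EuclideanSpace ℝ (Fin n)) (U : Set (EuclideanSpace ℝ (Fin n)))
    (ρ : EuclideanSpace ℝ (Fin n) → ℝ) : Prop where
  isOpen : IsOpen U
  mem : p ∈ U
  contDiffOn : ContDiffOn ℝ ∞ ρ U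
  eq_zero : ρ p = 0
  fderiv_ne_zero : fderiv ℝ ρ p ≠ 0
  inter_eq : M ∩ U = {x ∈ U | 0 ≤ ρ x}

/-- Compact connected domains of `ℝⁿ` with smooth boundary. -/
structure IsSmoothCompactDomain {n : ℕ} (M : Set (EuclideanSpace ℝ (Fin n))) : Prop where
  isCompact : IsCompact M
  isConnected : IsConnected M
  smooth_boundary : ∀ p ∈ frontier M, ∃ U ρ, IsDefiningFunctionAt M p U ρ

/-- `f ∈ C^∞(M)`, as restrictions to `M` of smooth functions on `ℝⁿ`. Only the values of `f` on
`M` matter. -/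
def SmoothOn {n : ℕ} (M : Set (EuclideanSpace ℝ (Fin n)))
    (f : EuclideanSpace ℝ (Fin n) → ℝ) : Prop :=
  ∃ F : EuclideanSpace ℝ (Fin n) → ℝ, ContDiff ℝ ∞ F ∧ EqOn f F M

/-! ### Norms, with values in `[0, ∞]` -/

/-- The norm of `C(S)`. -/
def supNorm {X : Type*} (S : Set X) (f : X → ℝ) : ℝ≥0∞ := ⨆ x ∈ S, ‖f x‖ₑ

/-- The norm of the differential at `p` of a function `f` on a subset `S` of a normed space.
A derivative of `f` within `S` at `p` is determined only on the tangent space of `S` at `p`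
(when `S` is a submanifold, possibly with boundary); the norm of the differential as a functional
on that tangent space is the smallest norm of such a derivative. It is `∞` if `f` is not
differentiable at `p` along `S`. -/
def diffNorm {X : Type*} [NormedAddCommGroup X] [NormedSpace ℝ X] (S : Set X) (f : X → ℝ)
    (p : X) : ℝ≥0∞ :=
  ⨅ (L : X →L[ℝ] ℝ) (_ : HasFDerivWithinAt f L S p), ‖L‖ₑ

/-- The norm of `C¹(S)`. -/
def c1Norm {X : Type*} [NormedAddCommGroup X] [NormedSpace ℝ X] (S : Set X) (f : X → ℝ) :
    ℝ≥0∞ :=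
  supNorm S f + ⨆ p ∈ S, diffNorm S f p

/-- The norm of `C²(M)` for a domain `M` of `ℝⁿ`. -/
def c2Norm {n : ℕ} (M : Set (EuclideanSpace ℝ (Fin n))) (f : EuclideanSpace ℝ (Fin n) → ℝ) :
    ℝ≥0∞ :=
  ∑ j ∈ Finset.range 3, ⨆ x ∈ M, ‖iteratedFDerivWithin ℝ j f M x‖ₑ

/-! ### Riemannian geometry in Cartesian coordinates

A Riemannian metric on `M ⊆ ℝⁿ` is given by its matrix `g x` in the Cartesian coordinates. -/

/-- The isotropic metric `c⁻² dx²`. -/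
def isotropicMetric {n : ℕ} (c : EuclideanSpace ℝ (Fin n) → ℝ) :
    EuclideanSpace ℝ (Fin n) → Matrix (Fin n) (Fin n) ℝ :=
  fun x => (c x ^ 2)⁻¹ • (1 : Matrix (Fin n) (Fin n) ℝ)

/-- The inner product `g_x(v, w)`. -/
def metricInner {n : ℕ} (g : EuclideanSpace ℝ (Fin n) → Matrix (Fin n) (Fin n) ℝ)
    (x v w : EuclideanSpace ℝ (Fin n)) : ℝ :=
  ∑ i, ∑ j, g x i j * v i * w j

/-- The partial derivative `∂ g_{ij} / ∂ x^k` on `M` (one-sided at the boundary). -/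
def metricDeriv {n : ℕ} (M : Set (EuclideanSpace ℝ (Fin n)))
    (g : EuclideanSpace ℝ (Fin n) → Matrix (Fin n) (Fin n) ℝ) (i j k : Fin n)
    (x : EuclideanSpace ℝ (Fin n)) : ℝ :=
  fderivWithin ℝ (fun z => g z i j) M x (EuclideanSpace.single k 1)

/-- The Christoffel symbol `Γ^j_{kl}` of `g` on `M`. -/
def christoffel {n : ℕ} (M : Set (EuclideanSpace ℝ (Fin n)))
    (g : EuclideanSpace ℝ (Fin n) → Matrix (Fin n) (Fin n) ℝ) (j k l : Fin n)
    (x : EuclideanSpace ℝ (Fin n)) : ℝ :=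
  (1 / 2) * ∑ m, (g x)⁻¹ j m *
    (metricDeriv M g m k l x + metricDeriv M g m l k x - metricDeriv M g k l m x)

/-- `ν` is the inward pointing unit normal vector of `∂M` at `y` with respect to `g`. The kernel of
the differential of a defining function is the tangent space of `∂M`. -/
def IsInwardUnitNormal {n : ℕ} (M : Set (EuclideanSpace ℝ (Fin n)))
    (g : EuclideanSpace ℝ (Fin n) → Matrix (Fin n) (Fin n) ℝ)
    (y ν : EuclideanSpace ℝ (Fin n)) : Prop :=
  metricInner g y ν ν = 1 ∧ ∃ U ρ, IsDefiningFunctionAt M y U ρ ∧ 0 < fderiv ℝ ρ y ν ∧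
    ∀ w, fderiv ℝ ρ y w = 0 → metricInner g y ν w = 0

/-- `γ`, restricted to `[0, s]`, is the geodesic `γ(·; y, ν)` of `(M, g)` that starts at `y ∈ ∂M`
with the inward unit normal as its initial velocity; in particular it stays in `M` up to the
time `s`. Here `v` is the velocity of `γ`. -/
def IsNormalGeodesic {n : ℕ} (M : Set (EuclideanSpace ℝ (Fin n)))
    (g : EuclideanSpace ℝ (Fin n) → Matrix (Fin n) (Fin n) ℝ)
    (y : EuclideanSpace ℝ (Fin n)) (s : ℝ) (γ : ℝ → EuclideanSpace ℝ (Fin n)) : Prop :=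
  γ 0 = y ∧ MapsTo γ (Icc 0 s) M ∧
    ∃ v : ℝ → EuclideanSpace ℝ (Fin n), IsInwardUnitNormal M g y (v 0) ∧
      ∀ t ∈ Icc 0 s, HasDerivWithinAt γ (v t) (Icc 0 s) t ∧
        HasDerivWithinAt v
          (WithLp.toLp 2 fun j => -∑ k, ∑ l, christoffel M g j k l (γ t) * v t k * v t l)
          (Icc 0 s) t

/-- The length with respect to `g` of a curve `α : [0, 1] → ℝⁿ`. -/
def curveLength {n : ℕ} (g : EuclideanSpace ℝ (Fin n) → Matrix (Fin n) (Fin n) ℝ)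
    (α : ℝ → EuclideanSpace ℝ (Fin n)) : ℝ≥0∞ :=
  ∫⁻ t in Icc (0 : ℝ) 1, ENNReal.ofReal (Real.sqrt
    (metricInner g (α t) (derivWithin α (Icc 0 1) t) (derivWithin α (Icc 0 1) t)))

/-- The Riemannian distance of `(M, g)`: the infimum of the lengths of the `C¹` curves in `M`
between two points (a piecewise `C¹` curve becomes `C¹` when it is reparametrized so as to stop
at its corners). -/
def riemDist {n : ℕ} (M : Set (EuclideanSpace ℝ (Fin n)))
    (g : EuclideanSpace ℝ (Fin n) → Matrix (Fin n) (Fin n) ℝ)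
    (x z : EuclideanSpace ℝ (Fin n)) : ℝ≥0∞ :=
  ⨅ α ∈ {α : ℝ → EuclideanSpace ℝ (Fin n) | ContDiffOn ℝ 1 α (Icc 0 1) ∧
    MapsTo α (Icc 0 1) M ∧ α 0 = x ∧ α 1 = z}, curveLength g α

/-- The distance `d(x, Γ)`. -/
def distTo {n : ℕ} (M : Set (EuclideanSpace ℝ (Fin n)))
    (g : EuclideanSpace ℝ (Fin n) → Matrix (Fin n) (Fin n) ℝ)
    (Γ : Set (EuclideanSpace ℝ (Fin n))) (x : EuclideanSpace ℝ (Fin n)) : ℝ≥0∞ :=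
  ⨅ z ∈ Γ, riemDist M g x z

/-! ### Semi-geodesic coordinates -/

/-- `σ_Γ(y)`: the maximal arc length for which the normal geodesic from `y`, as long as it stays
in `M`, minimizes the distance to `Γ`. -/
def sigma {n : ℕ} (M : Set (EuclideanSpace ℝ (Fin n)))
    (g : EuclideanSpace ℝ (Fin n) → Matrix (Fin n) (Fin n) ℝ)
    (Γ : Set (EuclideanSpace ℝ (Fin n))) (y : EuclideanSpace ℝ (Fin n)) : ℝ≥0∞ :=
  sSup {a : ℝ≥0∞ | ∃ s : ℝ, 0 < s ∧ a = ENNReal.ofReal s ∧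
    ∃ γ, IsNormalGeodesic M g y s γ ∧ distTo M g Γ (γ s) = ENNReal.ofReal s}

/-- The domain `{(y, s) : y ∈ Γ, 0 ≤ s < σ_Γ(y)}` of the semi-geodesic coordinate map. -/
def semiGeodesicDomain {n : ℕ} (M : Set (EuclideanSpace ℝ (Fin n)))
    (g : EuclideanSpace ℝ (Fin n) → Matrix (Fin n) (Fin n) ℝ)
    (Γ : Set (EuclideanSpace ℝ (Fin n))) : Set (EuclideanSpace ℝ (Fin n) × ℝ) :=
  {p | p.1 ∈ Γ ∧ 0 ≤ p.2 ∧ ENNReal.ofReal p.2 < sigma M g Γ p.1}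

open Classical in
/-- The map `Φ_g(y, s) = γ(s; y, ν)`. The geodesic is unique, and it exists on `[0, s]` when
`(y, s)` is in `semiGeodesicDomain M g Γ`; where it does not exist the value is irrelevant. -/
def Phi {n : ℕ} (M : Set (EuclideanSpace ℝ (Fin n)))
    (g : EuclideanSpace ℝ (Fin n) → Matrix (Fin n) (Fin n) ℝ)
    (p : EuclideanSpace ℝ (Fin n) × ℝ) : EuclideanSpace ℝ (Fin n) :=
  if h : ∃ γ, IsNormalGeodesic M g p.1 p.2 γ then h.choose p.2 else p.1

/-- The wave speeds `c`, smooth and strictly positive on `M`, such that for `g = c⁻² dx²` the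
semi-geodesic coordinate map `Φ_g` is defined on `Γ × [0, r₀)` and the image of this set contains
the closure of `Ω`. -/
def admissibleSpeeds {n : ℕ} (M Γ Ω : Set (EuclideanSpace ℝ (Fin n))) (r₀ : ℝ) :
    Set (EuclideanSpace ℝ (Fin n) → ℝ) :=
  {c | SmoothOn M c ∧ (∀ x ∈ M, 0 < c x) ∧
    Γ ×ˢ Ico 0 r₀ ⊆ semiGeodesicDomain M (isotropicMetric c) Γ ∧
    closure Ω ⊆ Phi M (isotropicMetric c) '' (Γ ×ˢ Ico 0 r₀)}

/-- The space `{φ ∈ C^∞(M) : Δφ = 0}` on which the operators `H_c` are defined. -/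
def harmonicFunctions {n : ℕ} (M : Set (EuclideanSpace ℝ (Fin n))) :
    Set (EuclideanSpace ℝ (Fin n) → ℝ) :=
  {φ | SmoothOn M φ ∧ InnerProductSpace.HarmonicOnNhd φ (interior M)}

/-- The operator `H_c φ = φ ∘ Φ_g`, `g = c⁻² dx²`. -/
def H {n : ℕ} (M : Set (EuclideanSpace ℝ (Fin n))) (c φ : EuclideanSpace ℝ (Fin n) → ℝ) :
    EuclideanSpace ℝ (Fin n) × ℝ → ℝ :=
  fun p => φ (Phi M (isotropicMetric c) p)

/-- The norm `‖A‖_{C¹(M) → C¹(S)}` of an operator `A` on the harmonic functions of `C^∞(M)`. -/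
def opNorm {n : ℕ} (M : Set (EuclideanSpace ℝ (Fin n)))
    (S : Set (EuclideanSpace ℝ (Fin n) × ℝ))
    (A : (EuclideanSpace ℝ (Fin n) → ℝ) → (EuclideanSpace ℝ (Fin n) × ℝ → ℝ)) : ℝ≥0∞ :=
  ⨆ φ ∈ {φ ∈ harmonicFunctions M | c1Norm M φ ≤ 1}, c1Norm S (A φ)

end SemiGeodesic

end

/-!
In Cartesian coordinates the geodesic equation of `c⁻² dx²` reads
`γ'' = c⁻¹ (2 ⟪∇c, γ'⟫ γ' - |γ'|² ∇c)`. It conserves `|γ'| / c`, so a geodesic that starts with a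
unit normal has Euclidean speed `c` at all times: in semi-geodesic coordinates, `c` is read off from
`Φ` as `c (Φ (y, s)) = |∂ₛ Φ (y, s)|`.

Linear functionals are harmonic. Testing `N = ‖H_{c'} - H_c‖` with suitable multiples of them bounds
both `|Φ_{c'} - Φ_c|` and `|∂ₛ Φ_{c'} - ∂ₛ Φ_c|` by `(R + 1) N`, where `R` is a bound for `|x|` on
`M`. Every `x ∈ Ω` is of the form `Φ_{c'} (y, s)`, and if `K` is a Lipschitz constant of `c`, then
`|c' x - c x| ≤ |c' (Φ_{c'} (y, s)) - c (Φ_c (y, s))| + K |Φ_{c'} (y, s) - Φ_c (y, s)|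
≤ (1 + K) (R + 1) N`. Finally `c'² - c² = (c' + c) (c' - c)`, and `c' + c` is bounded when `c'` is
close to `c`.
-/

namespace SemiGeodesic

open Filter Topology
open scoped Gradient NNReal RealInnerProductSpace

section LocallyLipschitz

variable {E F : Type*} [NormedAddCommGroup E] [NormedSpace ℝ E] [NormedAddCommGroup F]
  [NormedSpace ℝ F]

theorem locallyLipschitzOn_of_eqOn_contDiffAt {f g : E → F} {s : Set E}
    (hg : ∀ x ∈ s, ContDiffAt ℝ 1 g x) (hfg : EqOn f g s) : LocallyLipschitzOn s f := by
  intro x hx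
  obtain ⟨K, t, ht, hK⟩ := (hg x hx).exists_lipschitzOnWith
  refine ⟨K, s ∩ t, inter_mem_nhdsWithin s ht, fun a ha b hb => ?_⟩
  rw [hfg ha.1, hfg hb.1]
  exact hK ha.2 hb.2

theorem eqOn_Icc_of_locallyLipschitzOn {X : E → E} {S : Set E} (hX : LocallyLipschitzOn S X)
    {f g : ℝ → E} {a b : ℝ}
    (hf : ∀ t ∈ Icc a b, HasDerivWithinAt f (X (f t)) (Icc a b) t) (hfS : MapsTo f (Icc a b) S)
    (hg : ∀ t ∈ Icc a b, HasDerivWithinAt g (X (g t)) (Icc a b) t) (hgS : MapsTo g (Icc a b) S)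
    (hfg : f a = g a) : EqOn f g (Icc a b) := by
  have hfc : ContinuousOn f (Icc a b) := fun t ht => (hf t ht).continuousWithinAt
  have hgc : ContinuousOn g (Icc a b) := fun t ht => (hg t ht).continuousWithinAt
  obtain ⟨K, hK⟩ : ∃ K, LipschitzOnWith K X (f '' Icc a b ∪ g '' Icc a b) :=
    (hX.mono (union_subset hfS.image_subset hgS.image_subset)).exists_lipschitzOnWith_of_compact
      ((isCompact_Icc.image_of_continuousOn hfc).union (isCompact_Icc.image_of_continuousOn hgc))
  have hright : ∀ t ∈ Ico a b, t ∈ Icc a b ∧ Icc a b ∈ 𝓝[≥] t := fun t ht =>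
    ⟨Ico_subset_Icc_self ht, Icc_mem_nhdsGE_of_mem ht⟩
  exact ODE_solution_unique_of_mem_Icc_right (fun _ _ => hK)
    hfc (fun t ht => (hf t (hright t ht).1).mono_of_mem_nhdsWithin (hright t ht).2)
    (fun t ht => Or.inl (mem_image_of_mem f (hright t ht).1))
    hgc (fun t ht => (hg t (hright t ht).1).mono_of_mem_nhdsWithin (hright t ht).2)
    (fun t ht => Or.inr (mem_image_of_mem g (hright t ht).1)) hfg

end LocallyLipschitz

section IsotropicGeodesic

variable {E : Type*} [NormedAddCommGroup E] [InnerProductSpace ℝ E]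

/-- The acceleration of a geodesic of `c⁻² dx²` with velocity `v` at a point where `c` has the
value `a` and the Euclidean gradient `p`. -/
noncomputable def geodesicAcceleration (a : ℝ) (p v : E) : E :=
  a⁻¹ • ((2 * ⟪p, v⟫) • v - ‖v‖ ^ 2 • p)

theorem inner_geodesicAcceleration (a : ℝ) (p v : E) :
    ⟪v, geodesicAcceleration a p v⟫ = a⁻¹ * (⟪p, v⟫ * ‖v‖ ^ 2) := by
  rw [geodesicAcceleration, inner_smul_right, inner_sub_right, inner_smul_right, inner_smul_right,
    real_inner_self_eq_norm_sq, real_inner_comm v p]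
  ring

variable [CompleteSpace E]

/-- The vector field on the tangent bundle of `M` whose integral curves `(γ, γ')` are the geodesics
of `c⁻² dx²`. The gradient of `c` is taken within `M`, so it is one-sided at boundary points. -/
noncomputable def geodesicField (M : Set E) (c : E → ℝ) (z : E × E) : E × E :=
  (z.2, geodesicAcceleration (c z.1) (gradientWithin c M z.1) z.2)

/-- The curve `γ` with velocity `v` stays in `M` on `[0, s]` and solves the geodesic equation of
`c⁻² dx²` there. -/
structure IsIsotropicGeodesic (M : Set E) (c : E → ℝ) (s : ℝ) (γ v : ℝ → E) : Prop where
  mapsTo : MapsTo γ (Icc 0 s) M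
  hasDerivWithinAt : ∀ t ∈ Icc 0 s, HasDerivWithinAt γ (v t) (Icc 0 s) t
  hasDerivWithinAt_velocity : ∀ t ∈ Icc 0 s, HasDerivWithinAt v
    (geodesicAcceleration (c (γ t)) (gradientWithin c M (γ t)) (v t)) (Icc 0 s) t

variable {M : Set E} {c : E → ℝ}

theorem contDiffAt_geodesicField_univ {F : E → ℝ} {z : E × E} (hF : ContDiffAt ℝ 2 F z.1)
    (hz : F z.1 ≠ 0) : ContDiffAt ℝ 1 (geodesicField univ F) z := by
  have hF₁ : ContDiffAt ℝ 1 (fun z : E × E => F z.1) z :=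
    (hF.of_le one_le_two).comp z contDiffAt_fst
  have hgrad : ContDiffAt ℝ 1 (fun z : E × E => gradientWithin F univ z.1) z := by
    simp only [gradientWithin_univ]
    exact ((InnerProductSpace.toDual ℝ E).symm.contDiff.contDiffAt.comp z.1
      (hF.fderiv_right (m := 1) (by norm_num))).comp z contDiffAt_fst
  exact contDiffAt_snd.prodMk ((hF₁.inv hz).smul
    (((contDiffAt_const.mul (hgrad.inner ℝ contDiffAt_snd)).smul contDiffAt_snd).sub
      ((contDiffAt_snd.norm_sq ℝ).smul hgrad)))

theorem locallyLipschitzOn_geodesicField (hM : UniqueDiffOn ℝ M) {F : E → ℝ}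
    (hF : ∀ x ∈ M, ContDiffAt ℝ 2 F x) (hcF : EqOn c F M) (hc : ∀ x ∈ M, c x ≠ 0) :
    LocallyLipschitzOn (M ×ˢ univ) (geodesicField M c) := by
  refine locallyLipschitzOn_of_eqOn_contDiffAt (g := geodesicField univ F)
    (fun z hz => contDiffAt_geodesicField_univ (hF z.1 hz.1) (hcF hz.1 ▸ hc z.1 hz.1))
    fun z hz => ?_
  have hgrad : gradientWithin c M z.1 = gradientWithin F univ z.1 := by
    rw [gradientWithin, gradientWithin, fderivWithin_congr hcF (hcF hz.1), fderivWithin_univ,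
      ((hF z.1 hz.1).differentiableAt two_ne_zero).fderivWithin (hM z.1 hz.1)]
  simp only [geodesicField, hgrad, hcF hz.1]

namespace IsIsotropicGeodesic

variable {s : ℝ} {γ v γ' v' : ℝ → E}

theorem eqOn_of_locallyLipschitzOn (hL : LocallyLipschitzOn (M ×ˢ univ) (geodesicField M c))
    (h : IsIsotropicGeodesic M c s γ v) (h' : IsIsotropicGeodesic M c s γ' v')
    (hγ : γ 0 = γ' 0) (hv : v 0 = v' 0) : EqOn γ γ' (Icc 0 s) := by
  have hphase : EqOn (fun t => (γ t, v t)) (fun t => (γ' t, v' t)) (Icc 0 s) :=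
    eqOn_Icc_of_locallyLipschitzOn hL
      (fun t ht => (h.hasDerivWithinAt t ht).prodMk (h.hasDerivWithinAt_velocity t ht))
      (fun _ ht => ⟨h.mapsTo ht, mem_univ _⟩)
      (fun t ht => (h'.hasDerivWithinAt t ht).prodMk (h'.hasDerivWithinAt_velocity t ht))
      (fun _ ht => ⟨h'.mapsTo ht, mem_univ _⟩) (Prod.ext hγ hv)
  exact fun t ht => congrArg Prod.fst (hphase ht)

theorem norm_velocity_sq_div_sq_eq (h : IsIsotropicGeodesic M c s γ v)
    (hc : DifferentiableOn ℝ c M) (hc₀ : ∀ x ∈ M, c x ≠ 0) {t : ℝ} (ht : t ∈ Icc 0 s) :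
    ‖v t‖ ^ 2 / c (γ t) ^ 2 = ‖v 0‖ ^ 2 / c (γ 0) ^ 2 := by
  have hderiv : ∀ u ∈ Icc 0 s,
      HasDerivWithinAt (fun u => ‖v u‖ ^ 2 / c (γ u) ^ 2) 0 (Icc 0 s) u := by
    intro u hu
    have hcu : c (γ u) ≠ 0 := hc₀ _ (h.mapsTo hu)
    have hcγ : HasDerivWithinAt (c ∘ γ) ⟪gradientWithin c M (γ u), v u⟫ (Icc 0 s) u := by
      rw [inner_gradientWithin_left]
      exact (hc _ (h.mapsTo hu)).hasFDerivWithinAt.comp_hasDerivWithinAt u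
        (h.hasDerivWithinAt u hu) h.mapsTo
    refine ((h.hasDerivWithinAt_velocity u hu).norm_sq.div (hcγ.pow 2)
      (pow_ne_zero 2 hcu)).congr_deriv ?_
    rw [inner_geodesicAcceleration]
    simp only [Function.comp_apply, Pi.pow_apply]
    field_simp
    ring
  exact constant_of_has_deriv_right_zero (fun u hu => (hderiv u hu).continuousWithinAt)
    (fun u hu => (hderiv u (Ico_subset_Icc_self hu)).mono_of_mem_nhdsWithin
      (Icc_mem_nhdsGE_of_mem hu)) t ht

theorem norm_velocity_eq (h : IsIsotropicGeodesic M c s γ v) (hc : DifferentiableOn ℝ c M)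
    (hpos : ∀ x ∈ M, 0 < c x) (h₀ : ‖v 0‖ = c (γ 0)) {t : ℝ} (ht : t ∈ Icc 0 s) :
    ‖v t‖ = c (γ t) := by
  have hp : 0 < c (γ t) := hpos _ (h.mapsTo ht)
  have hp₀ : 0 < c (γ 0) := hpos _ (h.mapsTo ⟨le_rfl, ht.1.trans ht.2⟩)
  have hsq := h.norm_velocity_sq_div_sq_eq hc (fun x hx => (hpos x hx).ne') ht
  rw [h₀, div_self (pow_pos hp₀ 2).ne', div_eq_one_iff_eq (pow_pos hp 2).ne'] at hsq
  exact (pow_left_inj₀ (norm_nonneg _) hp.le two_ne_zero).1 hsq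

end IsIsotropicGeodesic

end IsotropicGeodesic

variable {n : ℕ} {M : Set (EuclideanSpace ℝ (Fin n))} {c : EuclideanSpace ℝ (Fin n) → ℝ}

section Christoffel

theorem gradientWithin_apply (M : Set (EuclideanSpace ℝ (Fin n)))
    (c : EuclideanSpace ℝ (Fin n) → ℝ) (x : EuclideanSpace ℝ (Fin n)) (k : Fin n) :
    gradientWithin c M x k = fderivWithin ℝ c M x (EuclideanSpace.single k 1) := by
  rw [← inner_gradientWithin_left, EuclideanSpace.inner_single_right]
  simp

theorem metricInner_isotropicMetric (c : EuclideanSpace ℝ (Fin n) → ℝ)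
    (x v w : EuclideanSpace ℝ (Fin n)) :
    metricInner (isotropicMetric c) x v w = (c x ^ 2)⁻¹ * ⟪v, w⟫ := by
  simp only [metricInner, isotropicMetric, Matrix.smul_apply, Matrix.one_apply, smul_eq_mul,
    mul_ite, mul_one, mul_zero, ite_mul, zero_mul, Finset.sum_ite_eq, Finset.mem_univ, if_true,
    PiLp.inner_apply, RCLike.inner_apply, conj_trivial, Finset.mul_sum]
  exact Finset.sum_congr rfl fun i _ => by ring

theorem inv_isotropicMetric {x : EuclideanSpace ℝ (Fin n)} (hx : c x ≠ 0) :
    (isotropicMetric c x)⁻¹ = c x ^ 2 • (1 : Matrix (Fin n) (Fin n) ℝ) :=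
  Matrix.inv_eq_left_inv (by simp [isotropicMetric, smul_smul, hx])

variable {x : EuclideanSpace ℝ (Fin n)}

theorem metricDeriv_isotropicMetric (hM : UniqueDiffWithinAt ℝ M x)
    (hc : DifferentiableWithinAt ℝ c M x) (hx : c x ≠ 0) (i j k : Fin n) :
    metricDeriv M (isotropicMetric c) i j k x =
      if i = j then -2 * (c x ^ 3)⁻¹ * gradientWithin c M x k else 0 := by
  have hinv : HasFDerivWithinAt (fun z => (c z ^ 2)⁻¹)
      ((-2 * (c x ^ 3)⁻¹) • fderivWithin ℝ c M x) M x := by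
    refine (((hasDerivAt_pow 2 (c x)).inv (pow_ne_zero 2 hx)).congr_deriv ?_).comp_hasFDerivWithinAt
      x hc.hasFDerivWithinAt
    field_simp
    norm_num
    ring
  split_ifs with hij
  · simp [metricDeriv, isotropicMetric, hij, hinv.fderivWithin hM, gradientWithin_apply]
  · simp [metricDeriv, isotropicMetric, hij]

theorem christoffel_isotropicMetric (hM : UniqueDiffWithinAt ℝ M x)
    (hc : DifferentiableWithinAt ℝ c M x) (hx : c x ≠ 0) (j k l : Fin n) :
    christoffel M (isotropicMetric c) j k l x = -(c x)⁻¹ *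
      ((if j = k then gradientWithin c M x l else 0) +
        (if j = l then gradientWithin c M x k else 0) -
        (if k = l then gradientWithin c M x j else 0)) := by
  simp only [christoffel, inv_isotropicMetric hx, metricDeriv_isotropicMetric hM hc hx,
    Matrix.smul_apply, Matrix.one_apply, smul_eq_mul, mul_ite, mul_one, mul_zero, ite_mul,
    zero_mul, Finset.sum_ite_eq, Finset.mem_univ, if_true]
  split_ifs <;> field_simp <;> ring

theorem neg_sum_christoffel_isotropicMetric (hM : UniqueDiffWithinAt ℝ M x)
    (hc : DifferentiableWithinAt ℝ c M x) (hx : c x ≠ 0) (v : EuclideanSpace ℝ (Fin n)) :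
    (WithLp.toLp 2 fun j =>
        -∑ k, ∑ l, christoffel M (isotropicMetric c) j k l x * v k * v l) =
      geodesicAcceleration (c x) (gradientWithin c M x) v := by
  ext j
  simp only [christoffel_isotropicMetric hM hc hx]
  set p := gradientWithin c M x
  have hinner : ⟪p, v⟫ = ∑ l, p l * v l := by
    simp [PiLp.inner_apply, mul_comm]
  have hsum : ∑ k, ∑ l, ((if j = k then p l else 0) + (if j = l then p k else 0) -
      (if k = l then p j else 0)) * (v k * v l) = 2 * ⟪p, v⟫ * v j - ‖v‖ ^ 2 * p j := by
    simp only [add_mul, sub_mul, ite_mul, zero_mul, Finset.sum_add_distrib,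
      Finset.sum_sub_distrib, Finset.sum_ite_irrel, Finset.sum_const_zero, Finset.sum_ite_eq,
      Finset.mem_univ, if_true, hinner, EuclideanSpace.real_norm_sq_eq, Finset.sum_mul,
      Finset.mul_sum]
    rw [← Finset.sum_add_distrib, ← Finset.sum_sub_distrib, ← Finset.sum_sub_distrib]
    exact Finset.sum_congr rfl fun k _ => by ring
  have hfactor : ∑ k, ∑ l, -(c x)⁻¹ * ((if j = k then p l else 0) + (if j = l then p k else 0) -
      (if k = l then p j else 0)) * v k * v l =
      -(c x)⁻¹ * (2 * ⟪p, v⟫ * v j - ‖v‖ ^ 2 * p j) := by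
    rw [← hsum]
    simp only [Finset.mul_sum, mul_assoc]
  simp only [hfactor, geodesicAcceleration, PiLp.smul_apply, PiLp.sub_apply, smul_eq_mul]
  ring

end Christoffel

namespace IsDefiningFunctionAt

variable {p w : EuclideanSpace ℝ (Fin n)} {U : Set (EuclideanSpace ℝ (Fin n))}
  {ρ : EuclideanSpace ℝ (Fin n) → ℝ}

theorem tendsto_slope (h : IsDefiningFunctionAt M p U ρ) (w : EuclideanSpace ℝ (Fin n)) :
    Tendsto (fun t : ℝ => t⁻¹ * ρ (p + t • w)) (𝓝[>] 0) (𝓝 (fderiv ℝ ρ p w)) := by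
  have hdiff : DifferentiableAt ℝ ρ p :=
    (h.contDiffOn.contDiffAt (h.isOpen.mem_nhds h.mem)).differentiableAt (by simp)
  simpa [h.eq_zero] using (hdiff.hasFDerivAt.hasLineDerivAt w).tendsto_slope_zero_right

theorem eventually_mem_nhds (h : IsDefiningFunctionAt M p U ρ) (w : EuclideanSpace ℝ (Fin n)) :
    ∀ᶠ t : ℝ in 𝓝[>] 0, p + t • w ∈ U := by
  have hline : Tendsto (fun t : ℝ => p + t • w) (𝓝 0) (𝓝 p) :=
    Continuous.tendsto' (by fun_prop) 0 p (by simp)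
  exact (hline.mono_left nhdsWithin_le_nhds).eventually_mem (h.isOpen.mem_nhds h.mem)

theorem mem_iff (h : IsDefiningFunctionAt M p U ρ) {x : EuclideanSpace ℝ (Fin n)} (hx : x ∈ U) :
    x ∈ M ↔ 0 ≤ ρ x := by
  simpa [hx] using Set.ext_iff.1 h.inter_eq x

theorem eventually_mem (h : IsDefiningFunctionAt M p U ρ) (hw : 0 < fderiv ℝ ρ p w) :
    ∀ᶠ t : ℝ in 𝓝[>] 0, p + t • w ∈ M := by
  filter_upwards [(h.tendsto_slope w).eventually_const_lt hw, h.eventually_mem_nhds w,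
    self_mem_nhdsWithin] with t hslope htU ht
  exact (h.mem_iff htU).2 ((pos_iff_pos_of_mul_pos hslope).1 (inv_pos.2 ht)).le

theorem fderiv_nonneg (h : IsDefiningFunctionAt M p U ρ)
    (hw : ∀ᶠ t : ℝ in 𝓝[>] 0, p + t • w ∈ M) : 0 ≤ fderiv ℝ ρ p w := by
  refine ge_of_tendsto (h.tendsto_slope w) ?_
  filter_upwards [hw, h.eventually_mem_nhds w, self_mem_nhdsWithin] with t htM htU ht
  exact mul_nonneg (inv_pos.2 ht).le ((h.mem_iff htU).1 htM)

theorem uniqueDiffWithinAt (h : IsDefiningFunctionAt M p U ρ) : UniqueDiffWithinAt ℝ M p := by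
  have hcone : {w | 0 < fderiv ℝ ρ p w} ⊆ tangentConeAt ℝ M p := fun w hw =>
    mem_tangentConeAt_of_add_smul_mem (c := fun t : ℝ => t) (l := 𝓝[>] 0)
      (tendsto_id.mono_left (nhdsWithin_mono _ fun t ht => ne_of_gt ht)) (h.eventually_mem hw)
  have hopen : IsOpen {w | 0 < fderiv ℝ ρ p w} :=
    isOpen_lt continuous_const (fderiv ℝ ρ p).continuous
  have hnonempty : {w | 0 < fderiv ℝ ρ p w}.Nonempty := by
    obtain ⟨w, hw⟩ := DFunLike.ne_iff.1 h.fderiv_ne_zero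
    rcases lt_or_gt_of_ne hw with hneg | hpos
    · exact ⟨-w, by simpa using hneg⟩
    · exact ⟨w, hpos⟩
  have hspan : Submodule.span ℝ (tangentConeAt ℝ M p) = ⊤ :=
    Submodule.eq_top_of_nonempty_interior' _ (hnonempty.mono
      (interior_maximal (hcone.trans Submodule.subset_span) hopen))
  exact ⟨hspan ▸ dense_univ, subset_closure ((h.mem_iff h.mem).2 h.eq_zero.ge)⟩

end IsDefiningFunctionAt

theorem IsSmoothCompactDomain.uniqueDiffOn (hM : IsSmoothCompactDomain M) :
    UniqueDiffOn ℝ M := by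
  intro p hp
  by_cases hpi : p ∈ interior M
  · exact uniqueDiffWithinAt_of_mem_nhds (mem_interior_iff_mem_nhds.1 hpi)
  · obtain ⟨U, ρ, h⟩ := hM.smooth_boundary p ⟨subset_closure hp, hpi⟩
    exact h.uniqueDiffWithinAt

namespace IsInwardUnitNormal

variable {y ν ν' w : EuclideanSpace ℝ (Fin n)}

theorem norm_eq (h : IsInwardUnitNormal M (isotropicMetric c) y ν) : ‖ν‖ = |c y| := by
  have hunit := h.1
  rw [metricInner_isotropicMetric, real_inner_self_eq_norm_sq] at hunit
  have hy : c y ^ 2 ≠ 0 := by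
    intro hy
    simp [hy] at hunit
  rw [inv_mul_eq_one₀ hy] at hunit
  rw [← abs_norm ν, ← sq_eq_sq_iff_abs_eq_abs, hunit]

theorem exists_isDefiningFunctionAt (h : IsInwardUnitNormal M (isotropicMetric c) y ν) :
    ∃ U ρ, IsDefiningFunctionAt M y U ρ ∧ ∃ k, 0 < k ∧ ∀ w, fderiv ℝ ρ y w = k * ⟪ν, w⟫ := by
  obtain ⟨hunit, U, ρ, hρ, hpos, hker⟩ := h
  refine ⟨U, ρ, hρ, fderiv ℝ ρ y ν * (c y ^ 2)⁻¹, ?_, fun w => ?_⟩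
  · have hy : c y ≠ 0 := by
      intro hy
      simp [metricInner_isotropicMetric, hy] at hunit
    positivity
  · have horth := hker (fderiv ℝ ρ y w • ν - fderiv ℝ ρ y ν • w) (by simp [mul_comm])
    rw [metricInner_isotropicMetric] at hunit horth
    rw [inner_sub_right, inner_smul_right, inner_smul_right] at horth
    linear_combination horth - fderiv ℝ ρ y w * hunit

theorem eventually_mem (h : IsInwardUnitNormal M (isotropicMetric c) y ν) (hw : 0 < ⟪ν, w⟫) :
    ∀ᶠ t : ℝ in 𝓝[>] 0, y + t • w ∈ M := by
  obtain ⟨U, ρ, hρ, k, hk, hfderiv⟩ := h.exists_isDefiningFunctionAt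
  exact hρ.eventually_mem (hfderiv w ▸ mul_pos hk hw)

theorem inner_nonneg (h : IsInwardUnitNormal M (isotropicMetric c) y ν)
    (hw : ∀ᶠ t : ℝ in 𝓝[>] 0, y + t • w ∈ M) : 0 ≤ ⟪ν, w⟫ := by
  obtain ⟨U, ρ, hρ, k, hk, hfderiv⟩ := h.exists_isDefiningFunctionAt
  exact nonneg_of_mul_nonneg_right (hfderiv w ▸ hρ.fderiv_nonneg hw) hk

theorem unique (h : IsInwardUnitNormal M (isotropicMetric c) y ν)
    (h' : IsInwardUnitNormal M (isotropicMetric c) y ν') : ν = ν' := by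
  have hnorm : ‖ν‖ = ‖ν'‖ := h.norm_eq.trans h'.norm_eq.symm
  have hsq : ‖ν - ν'‖ ^ 2 = 2 * ⟪ν, ν - ν'⟫ := by
    rw [norm_sub_sq_real, inner_sub_right, real_inner_self_eq_norm_sq, hnorm]
    ring
  have hsq' : ‖ν - ν'‖ ^ 2 = -2 * ⟪ν', ν - ν'⟫ := by
    rw [norm_sub_sq_real, inner_sub_right, real_inner_self_eq_norm_sq, hnorm,
      real_inner_comm ν ν']
    ring
  by_contra hne
  have hpos : 0 < ‖ν - ν'‖ ^ 2 := pow_pos (norm_pos_iff.2 (sub_ne_zero.2 hne)) 2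
  have hinward : ∀ᶠ t : ℝ in 𝓝[>] 0, y + t • (ν - ν') ∈ M := h.eventually_mem (by linarith)
  linarith [h'.inner_nonneg hinward]

end IsInwardUnitNormal

namespace SmoothOn

theorem differentiableOn (hc : SmoothOn M c) : DifferentiableOn ℝ c M := by
  obtain ⟨F, hF, hcF⟩ := hc
  exact (hF.differentiable (by simp)).differentiableOn.congr hcF

theorem exists_lipschitzOnWith (hM : IsCompact M) (hc : SmoothOn M c) :
    ∃ K, LipschitzOnWith K c M := by
  obtain ⟨F, hF, hcF⟩ := hc
  exact (locallyLipschitzOn_of_eqOn_contDiffAt (fun _ _ => (hF.of_le (by simp)).contDiffAt)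
    hcF).exists_lipschitzOnWith_of_compact hM

theorem locallyLipschitzOn_geodesicField (hM : UniqueDiffOn ℝ M) (hc : SmoothOn M c)
    (hc₀ : ∀ x ∈ M, c x ≠ 0) : LocallyLipschitzOn (M ×ˢ univ) (geodesicField M c) := by
  obtain ⟨F, hF, hcF⟩ := hc
  exact SemiGeodesic.locallyLipschitzOn_geodesicField hM
    (fun _ _ => hF.contDiffAt.of_le (mod_cast ENat.LEInfty.out)) hcF hc₀

end SmoothOn

section SemiGeodesicCoordinates

variable {Γ : Set (EuclideanSpace ℝ (Fin n))} {y : EuclideanSpace ℝ (Fin n)} {s t : ℝ}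
  {g : EuclideanSpace ℝ (Fin n) → Matrix (Fin n) (Fin n) ℝ}
  {γ γ' : ℝ → EuclideanSpace ℝ (Fin n)}

namespace IsNormalGeodesic

theorem mono (h : IsNormalGeodesic M g y s γ) (hts : t ≤ s) : IsNormalGeodesic M g y t γ := by
  have hsub : Icc 0 t ⊆ Icc 0 s := Icc_subset_Icc_right hts
  obtain ⟨h₀, hmaps, v, hv, hode⟩ := h
  exact ⟨h₀, hmaps.mono_left hsub, v, hv, fun u hu =>
    ⟨(hode u (hsub hu)).1.mono hsub, (hode u (hsub hu)).2.mono hsub⟩⟩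

theorem exists_velocity (hM : UniqueDiffOn ℝ M) (hc : DifferentiableOn ℝ c M)
    (hc₀ : ∀ x ∈ M, c x ≠ 0) (h : IsNormalGeodesic M (isotropicMetric c) y s γ) :
    ∃ v, IsIsotropicGeodesic M c s γ v ∧ IsInwardUnitNormal M (isotropicMetric c) y (v 0) := by
  obtain ⟨-, hmaps, v, hv, hode⟩ := h
  refine ⟨v, ⟨hmaps, fun t ht => (hode t ht).1, fun t ht => ?_⟩, hv⟩
  rw [← neg_sum_christoffel_isotropicMetric (hM _ (hmaps ht)) (hc _ (hmaps ht)) (hc₀ _ (hmaps ht))]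
  exact (hode t ht).2

theorem eqOn (hM : UniqueDiffOn ℝ M) (hc : SmoothOn M c) (hc₀ : ∀ x ∈ M, c x ≠ 0)
    (h : IsNormalGeodesic M (isotropicMetric c) y s γ)
    (h' : IsNormalGeodesic M (isotropicMetric c) y s γ') : EqOn γ γ' (Icc 0 s) := by
  obtain ⟨v, hγ, hv⟩ := h.exists_velocity hM hc.differentiableOn hc₀
  obtain ⟨v', hγ', hv'⟩ := h'.exists_velocity hM hc.differentiableOn hc₀
  exact hγ.eqOn_of_locallyLipschitzOn (hc.locallyLipschitzOn_geodesicField hM hc₀) hγ'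
    (h.1.trans h'.1.symm) (hv.unique hv')

theorem Phi_eq (hM : UniqueDiffOn ℝ M) (hc : SmoothOn M c) (hc₀ : ∀ x ∈ M, c x ≠ 0)
    (h : IsNormalGeodesic M (isotropicMetric c) y s γ) (ht : t ∈ Icc 0 s) :
    Phi M (isotropicMetric c) (y, t) = γ t := by
  have hex : ∃ γ, IsNormalGeodesic M (isotropicMetric c) y t γ := ⟨γ, h.mono ht.2⟩
  rw [Phi, dif_pos hex]
  exact hex.choose_spec.eqOn hM hc hc₀ (h.mono ht.2) ⟨ht.1, le_rfl⟩

end IsNormalGeodesic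

theorem exists_isNormalGeodesic_of_mem_semiGeodesicDomain
    (h : (y, s) ∈ semiGeodesicDomain M g Γ) : ∃ s' > s, ∃ γ, IsNormalGeodesic M g y s' γ := by
  obtain ⟨-, -, hlt⟩ := h
  obtain ⟨_, ⟨s', hs', rfl, γ, hγ, -⟩, hlt'⟩ := lt_sSup_iff.1 hlt
  exact ⟨s', (ENNReal.ofReal_lt_ofReal_iff hs').1 hlt', γ, hγ⟩

theorem exists_norm_eq_and_hasDerivWithinAt_Phi (hM : UniqueDiffOn ℝ M) (hc : SmoothOn M c)
    (hpos : ∀ x ∈ M, 0 < c x) (h : (y, s) ∈ semiGeodesicDomain M (isotropicMetric c) Γ) :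
    Phi M (isotropicMetric c) (y, s) ∈ M ∧
      ∃ w, ‖w‖ = c (Phi M (isotropicMetric c) (y, s)) ∧
        HasDerivWithinAt (fun t => Phi M (isotropicMetric c) (y, t)) w (Ici 0) s := by
  have hc₀ : ∀ x ∈ M, c x ≠ 0 := fun x hx => (hpos x hx).ne'
  obtain ⟨s', hs', γ, hγ⟩ := exists_isNormalGeodesic_of_mem_semiGeodesicDomain h
  have hs : s ∈ Icc 0 s' := ⟨h.2.1, hs'.le⟩
  have hΦ : EqOn (fun t => Phi M (isotropicMetric c) (y, t)) γ (Icc 0 s') :=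
    fun t ht => hγ.Phi_eq hM hc hc₀ ht
  obtain ⟨v, hv, hν⟩ := hγ.exists_velocity hM hc.differentiableOn hc₀
  have hyM : γ 0 ∈ M := hγ.2.1 ⟨le_rfl, hs.1.trans hs.2⟩
  have hnorm : ‖v 0‖ = c (γ 0) := by
    rw [hν.norm_eq, ← hγ.1, abs_of_pos (hpos _ hyM)]
  have hnhds : Icc 0 s' ∈ 𝓝[Ici 0] s :=
    mem_of_superset (inter_mem_nhdsWithin _ (Iio_mem_nhds hs')) fun _ hu => ⟨hu.1, le_of_lt hu.2⟩
  rw [hγ.Phi_eq hM hc hc₀ hs]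
  exact ⟨hv.mapsTo hs, v s, hv.norm_velocity_eq hc.differentiableOn hpos hnorm hs,
    ((hv.hasDerivWithinAt s hs).congr_of_mem hΦ hs).mono_of_mem_nhdsWithin hnhds⟩

theorem subset_of_mem_admissibleSpeeds {Ω : Set (EuclideanSpace ℝ (Fin n))} {r₀ : ℝ}
    (hM : UniqueDiffOn ℝ M) (hc : c ∈ admissibleSpeeds M Γ Ω r₀) : Ω ⊆ M := by
  obtain ⟨hsmooth, hpos, hdom, himage⟩ := hc
  refine subset_closure.trans (himage.trans ?_)
  rintro _ ⟨p, hp, rfl⟩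
  exact (exists_norm_eq_and_hasDerivWithinAt_Phi hM hsmooth hpos (hdom hp)).1

end SemiGeodesicCoordinates

section Norms

variable {X : Type*} {S T : Set X} {f : X → ℝ}

theorem supNorm_le_iff {N : ℝ≥0∞} : supNorm S f ≤ N ↔ ∀ x ∈ S, ‖f x‖ₑ ≤ N :=
  iSup₂_le_iff

theorem enorm_le_supNorm {x : X} (hx : x ∈ S) : ‖f x‖ₑ ≤ supNorm S f :=
  supNorm_le_iff.1 le_rfl x hx

theorem supNorm_mono (hST : S ⊆ T) : supNorm S f ≤ supNorm T f :=
  biSup_mono hST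

theorem supNorm_sq_sub_sq_le (S : Set X) (f g : X → ℝ) :
    supNorm S (fun x => f x ^ 2 - g x ^ 2) ≤
      (supNorm S (fun x => f x - g x) + 2 * supNorm S g) * supNorm S (fun x => f x - g x) := by
  refine supNorm_le_iff.2 fun x hx => ?_
  calc ‖f x ^ 2 - g x ^ 2‖ₑ = ‖(f x - g x) + 2 * g x‖ₑ * ‖f x - g x‖ₑ := by
        rw [← enorm_mul]; ring_nf
    _ ≤ (‖f x - g x‖ₑ + ‖2 * g x‖ₑ) * ‖f x - g x‖ₑ := by gcongr; exact enorm_add_le _ _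
    _ ≤ _ := by
      rw [enorm_mul, Real.enorm_eq_ofReal zero_le_two, ENNReal.ofReal_ofNat]
      gcongr
      exacts [enorm_le_supNorm (f := fun x => f x - g x) hx, enorm_le_supNorm hx,
        enorm_le_supNorm (f := fun x => f x - g x) hx]

theorem supNorm_le_c2Norm (M : Set (EuclideanSpace ℝ (Fin n)))
    (f : EuclideanSpace ℝ (Fin n) → ℝ) : supNorm M f ≤ c2Norm M f := by
  have hzero : supNorm M f = ⨆ x ∈ M, ‖iteratedFDerivWithin ℝ 0 f M x‖ₑ := by
    simp only [supNorm, ← ofReal_norm, norm_iteratedFDerivWithin_zero]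
  rw [hzero, c2Norm]
  exact Finset.single_le_sum (f := fun j => ⨆ x ∈ M, ‖iteratedFDerivWithin ℝ j f M x‖ₑ)
    (fun _ _ => zero_le) (Finset.mem_range.2 three_pos)

theorem exists_pos_enorm_le_of_isBounded [SeminormedAddGroup X] (hS : Bornology.IsBounded S) :
    ∃ R : ℝ≥0, 0 < R ∧ ∀ x ∈ S, ‖x‖ₑ ≤ R := by
  obtain ⟨R, hR₀, hR⟩ := hS.exists_pos_norm_le
  lift R to ℝ≥0 using hR₀.le
  exact ⟨R, NNReal.coe_pos.1 hR₀, fun x hx => enorm_le_coe.2 (hR x hx)⟩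

variable [NormedAddCommGroup X] [NormedSpace ℝ X]

theorem enorm_le_mul_of_forall_clm {r : ℝ≥0} (hr : r ≠ 0) {N : ℝ≥0∞} {d : X}
    (h : ∀ L : X →L[ℝ] ℝ, ‖L‖ₑ * r ≤ 1 → ‖L d‖ₑ ≤ N) : ‖d‖ₑ ≤ r * N := by
  obtain ⟨L, hL, hLd⟩ := exists_dual_vector'' ℝ d
  have hr' : ‖(r : ℝ)⁻¹‖ₑ = (r : ℝ≥0∞)⁻¹ := by
    rw [enorm_inv (by simpa using hr)]
    simp
  have hle : ‖((r : ℝ)⁻¹ • L) d‖ₑ ≤ N := by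
    refine h _ ?_
    rw [enorm_smul, hr', mul_right_comm, ENNReal.inv_mul_cancel (by simpa using hr) (by simp),
      one_mul]
    rw [← ofReal_norm]
    exact ENNReal.ofReal_le_one.2 hL
  rw [smul_apply, enorm_smul, hr', hLd, RCLike.ofReal_real_eq_id, id, enorm_norm,
    ENNReal.inv_mul_le_iff (by simpa using hr) (by simp)] at hle
  exact hle

theorem c1Norm_clm_le (L : X →L[ℝ] ℝ) {R : ℝ≥0∞} (hR : ∀ x ∈ S, ‖x‖ₑ ≤ R) :
    c1Norm S L ≤ ‖L‖ₑ * (R + 1) := by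
  rw [mul_add, mul_one]
  refine add_le_add (supNorm_le_iff.2 fun x hx => ?_) (iSup₂_le fun x _ => ?_)
  · exact (L.le_opENorm x).trans (by gcongr; exact hR x hx)
  · exact iInf₂_le L L.hasFDerivWithinAt

theorem enorm_le_diffNorm {T : Set ℝ} {t a : ℝ} {σ : ℝ → X} {u : X}
    (hT : UniqueDiffWithinAt ℝ T t) (hσ : HasDerivWithinAt σ u T t) (hσS : MapsTo σ T S)
    (hu : ‖u‖ₑ ≤ 1) (hf : HasDerivWithinAt (f ∘ σ) a T t) : ‖a‖ₑ ≤ diffNorm S f (σ t) := by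
  refine le_iInf₂ fun L hL => ?_
  rw [hT.eq_deriv _ hf (hL.comp_hasDerivWithinAt t hσ hσS)]
  exact (L.le_opENorm u).trans (mul_le_of_le_one_right' hu)

end Norms

section TestFunctionals

theorem harmonicOnNhd_clm {E : Type*} [NormedAddCommGroup E] [InnerProductSpace ℝ E]
    [FiniteDimensional ℝ E] (L : E →L[ℝ] ℝ) (s : Set E) :
    InnerProductSpace.HarmonicOnNhd L s := by
  intro x _
  refine ⟨L.contDiff.contDiffAt, Eventually.of_forall fun z => ?_⟩
  rw [InnerProductSpace.laplacian_eq_iteratedFDeriv_stdOrthonormalBasis]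
  have hfderiv : fderiv ℝ L = fun _ => L := funext fun z => L.fderiv
  simp [iteratedFDeriv_two_apply, hfderiv]

variable {R : ℝ≥0} {S : Set (EuclideanSpace ℝ (Fin n) × ℝ)}

theorem c1Norm_clm_le_opNorm (hR : ∀ x ∈ M, ‖x‖ₑ ≤ R) {L : EuclideanSpace ℝ (Fin n) →L[ℝ] ℝ}
    (hL : ‖L‖ₑ * (R + 1) ≤ 1)
    (A : (EuclideanSpace ℝ (Fin n) → ℝ) → EuclideanSpace ℝ (Fin n) × ℝ → ℝ) :
    c1Norm S (A L) ≤ opNorm M S A :=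
  le_iSup₂ (f := fun φ (_ : φ ∈ {φ ∈ harmonicFunctions M | c1Norm M φ ≤ 1}) => c1Norm S (A φ)) L
    ⟨⟨⟨L, L.contDiff, fun _ _ => rfl⟩, harmonicOnNhd_clm L _⟩, (c1Norm_clm_le L hR).trans hL⟩

variable {Ψ Ψ' : EuclideanSpace ℝ (Fin n) × ℝ → EuclideanSpace ℝ (Fin n)}

theorem enorm_sub_le_mul_opNorm (hR : ∀ x ∈ M, ‖x‖ₑ ≤ R) {p : EuclideanSpace ℝ (Fin n) × ℝ}
    (hp : p ∈ S) :
    ‖Ψ' p - Ψ p‖ₑ ≤ (R + 1) * opNorm M S (fun φ => φ ∘ Ψ' - φ ∘ Ψ) := by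
  refine enorm_le_mul_of_forall_clm (r := R + 1) (by positivity) fun L hL => ?_
  calc ‖L (Ψ' p - Ψ p)‖ₑ = ‖(L ∘ Ψ' - L ∘ Ψ) p‖ₑ := by simp
    _ ≤ c1Norm S (L ∘ Ψ' - L ∘ Ψ) := (enorm_le_supNorm hp).trans le_self_add
    _ ≤ _ := c1Norm_clm_le_opNorm hR (mod_cast hL) fun φ => φ ∘ Ψ' - φ ∘ Ψ

theorem enorm_velocity_sub_le_mul_opNorm (hR : ∀ x ∈ M, ‖x‖ₑ ≤ R) {T : Set ℝ}
    {y w w' : EuclideanSpace ℝ (Fin n)} {s : ℝ} (hT : UniqueDiffWithinAt ℝ T s) (hs : s ∈ T)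
    (hTS : ∀ t ∈ T, (y, t) ∈ S) (hw : HasDerivWithinAt (fun t => Ψ (y, t)) w T s)
    (hw' : HasDerivWithinAt (fun t => Ψ' (y, t)) w' T s) :
    ‖w' - w‖ₑ ≤ (R + 1) * opNorm M S (fun φ => φ ∘ Ψ' - φ ∘ Ψ) := by
  refine enorm_le_mul_of_forall_clm (r := R + 1) (by positivity) fun L hL => ?_
  have hcurve : HasDerivWithinAt (fun t : ℝ => (y, t)) (0, 1) T s :=
    (hasDerivWithinAt_const s T y).prodMk (hasDerivWithinAt_id s T)
  have hderiv : HasDerivWithinAt ((L ∘ Ψ' - L ∘ Ψ) ∘ fun t : ℝ => (y, t)) (L (w' - w)) T s := by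
    rw [map_sub]
    exact (L.hasFDerivAt.comp_hasDerivWithinAt s hw').sub
      (L.hasFDerivAt.comp_hasDerivWithinAt s hw)
  calc ‖L (w' - w)‖ₑ ≤ diffNorm S (L ∘ Ψ' - L ∘ Ψ) (y, s) :=
        enorm_le_diffNorm hT hcurve hTS (by simp [← ofReal_norm, Prod.norm_def]) hderiv
    _ ≤ c1Norm S (L ∘ Ψ' - L ∘ Ψ) :=
        (le_iSup₂ (f := fun p (_ : p ∈ S) => diffNorm S (L ∘ Ψ' - L ∘ Ψ) p) _
          (hTS s hs)).trans le_add_self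
    _ ≤ _ := c1Norm_clm_le_opNorm hR (mod_cast hL) fun φ => φ ∘ Ψ' - φ ∘ Ψ

end TestFunctionals

section Stability

variable {Γ Ω : Set (EuclideanSpace ℝ (Fin n))} {r₀ : ℝ} {c' : EuclideanSpace ℝ (Fin n) → ℝ}

theorem supNorm_sub_le_mul_opNorm (hM : UniqueDiffOn ℝ M) {R K : ℝ≥0} (hR : ∀ x ∈ M, ‖x‖ₑ ≤ R)
    (hK : LipschitzOnWith K c M) (hc : c ∈ admissibleSpeeds M Γ Ω r₀)
    (hc' : c' ∈ admissibleSpeeds M Γ Ω r₀) :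
    supNorm Ω (fun x => c' x - c x) ≤
      (1 + K) * ((R + 1) * opNorm M (Γ ×ˢ Ico 0 r₀) (fun φ => H M c' φ - H M c φ)) := by
  obtain ⟨hsmooth, hpos, hdom, -⟩ := hc
  obtain ⟨hsmooth', hpos', hdom', himage⟩ := hc'
  refine supNorm_le_iff.2 fun x hx => ?_
  obtain ⟨⟨y, s⟩, hys, rfl⟩ := himage (subset_closure hx)
  obtain ⟨hΦM, w, hw, hΦ⟩ := exists_norm_eq_and_hasDerivWithinAt_Phi hM hsmooth hpos (hdom hys)
  obtain ⟨hΦM', w', hw', hΦ'⟩ :=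
    exists_norm_eq_and_hasDerivWithinAt_Phi hM hsmooth' hpos' (hdom' hys)
  set Φ := Phi M (isotropicMetric c)
  set Φ' := Phi M (isotropicMetric c')
  set N := opNorm M (Γ ×ˢ Ico 0 r₀) (fun φ => H M c' φ - H M c φ)
  have hpoint : ‖Φ' (y, s) - Φ (y, s)‖ₑ ≤ (R + 1) * N := enorm_sub_le_mul_opNorm hR hys
  have hvelocity : ‖w' - w‖ₑ ≤ (R + 1) * N :=
    enorm_velocity_sub_le_mul_opNorm hR (uniqueDiffOn_Ico 0 r₀ s hys.2) hys.2
      (fun t ht => mk_mem_prod hys.1 ht) (hΦ.mono Ico_subset_Ici_self)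
      (hΦ'.mono Ico_subset_Ici_self)
  have hspeed : ‖c' (Φ' (y, s)) - c (Φ (y, s))‖ₑ ≤ ‖w' - w‖ₑ := by
    rw [← hw, ← hw']
    exact enorm_le_iff_norm_le.2 (abs_norm_sub_norm_le w' w)
  have hlip : ‖c (Φ (y, s)) - c (Φ' (y, s))‖ₑ ≤ K * ‖Φ' (y, s) - Φ (y, s)‖ₑ := by
    simpa only [edist_eq_enorm_sub, enorm_sub_rev (Φ (y, s))] using hK hΦM hΦM'
  calc ‖c' (Φ' (y, s)) - c (Φ' (y, s))‖ₑ
      = ‖(c' (Φ' (y, s)) - c (Φ (y, s))) + (c (Φ (y, s)) - c (Φ' (y, s)))‖ₑ := by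
        rw [sub_add_sub_cancel]
    _ ≤ ‖w' - w‖ₑ + K * ‖Φ' (y, s) - Φ (y, s)‖ₑ :=
        (enorm_add_le _ _).trans (add_le_add hspeed hlip)
    _ ≤ (R + 1) * N + K * ((R + 1) * N) := by gcongr
    _ = (1 + K) * ((R + 1) * N) := by ring

end Stability

end SemiGeodesic

open SemiGeodesic in
theorem mainTheorem1_general {n : ℕ} {M : Set (EuclideanSpace ℝ (Fin n))} (hMc : IsCompact M)
    (hM : UniqueDiffOn ℝ M) {Γ Ω : Set (EuclideanSpace ℝ (Fin n))} {r₀ : ℝ}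
    {c : EuclideanSpace ℝ (Fin n) → ℝ} (hc : c ∈ admissibleSpeeds M Γ Ω r₀) (ε : ℝ) :
    ∃ C : ℝ, 0 < C ∧ ∀ c' ∈ admissibleSpeeds M Γ Ω r₀,
      supNorm Ω (fun x => c' x - c x) ≤ ENNReal.ofReal ε →
      supNorm Ω (fun x => c' x ^ 2 - c x ^ 2) ≤
        ENNReal.ofReal C *
          opNorm M (Γ ×ˢ Set.Ico 0 r₀) (fun φ => H M c' φ - H M c φ) := by
  obtain ⟨R, -, hR⟩ := exists_pos_enorm_le_of_isBounded hMc.isBounded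
  obtain ⟨K, hK⟩ := hc.1.exists_lipschitzOnWith hMc
  obtain ⟨B, hB₀, hB⟩ := exists_pos_enorm_le_of_isBounded
    (hMc.image_of_continuousOn hK.continuousOn).isBounded
  have hcB : supNorm Ω c ≤ B := supNorm_le_iff.2 fun x hx =>
    hB _ (mem_image_of_mem c (subset_of_mem_admissibleSpeeds hM hc hx))
  refine ⟨((ε.toNNReal + 2 * B) * ((1 + K) * (R + 1)) : NNReal), by positivity, fun c' hc' hε => ?_⟩
  set N := opNorm M (Γ ×ˢ Set.Ico 0 r₀) (fun φ => H M c' φ - H M c φ)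
  calc supNorm Ω (fun x => c' x ^ 2 - c x ^ 2)
      ≤ (supNorm Ω (fun x => c' x - c x) + 2 * supNorm Ω c) * supNorm Ω (fun x => c' x - c x) :=
        supNorm_sq_sub_sq_le Ω c' c
    _ ≤ (ENNReal.ofReal ε + 2 * B) * ((1 + K) * ((R + 1) * N)) := by
        gcongr
        exact supNorm_sub_le_mul_opNorm hM hR hK hc hc'
    _ = ENNReal.ofReal ((ε.toNNReal + 2 * B) * ((1 + K) * (R + 1)) : NNReal) * N := by
        rw [ENNReal.ofReal_coe_nnreal]
        simp only [ENNReal.coe_mul, ENNReal.coe_add, ENNReal.coe_one, ENNReal.coe_ofNat,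
          ENNReal.ofReal, mul_assoc]

theorem mainTheorem1 {n : ℕ} (M : Set (EuclideanSpace ℝ (Fin n)))
    (hM : SemiGeodesic.IsSmoothCompactDomain M)
    (Γ : Set (EuclideanSpace ℝ (Fin n)))
    (hΓ : ∃ V : Set (EuclideanSpace ℝ (Fin n)), IsOpen V ∧ Γ = V ∩ frontier M)
    (r₀ : ℝ) (hr₀ : 0 < r₀)
    (Ω : Set (EuclideanSpace ℝ (Fin n))) (hΩ : Ω ⊆ M)
    (G : Set (EuclideanSpace ℝ (Fin n) → ℝ))
    (hG : G ⊆ SemiGeodesic.admissibleSpeeds M Γ Ω r₀)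
    (c : EuclideanSpace ℝ (Fin n) → ℝ) (hc : c ∈ G) :
    ∃ ε : ℝ, 0 < ε ∧ ∃ C : ℝ, 0 < C ∧ ∀ c' ∈ G,
      SemiGeodesic.c2Norm M (fun x => c' x - c x) ≤ ENNReal.ofReal ε →
      SemiGeodesic.supNorm Ω (fun x => c' x ^ 2 - c x ^ 2) ≤
        ENNReal.ofReal C *
          SemiGeodesic.opNorm M (Γ ×ˢ Set.Ico 0 r₀)
            (fun φ => SemiGeodesic.H M c' φ - SemiGeodesic.H M c φ) := by
  obtain ⟨C, hC, hbound⟩ :=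
    mainTheorem1_general hM.isCompact hM.uniqueDiffOn (hG hc) 1
  exact ⟨1, one_pos, C, hC, fun c' hc' hclose => hbound c' (hG hc')
    ((SemiGeodesic.supNorm_mono hΩ).trans
      ((SemiGeodesic.supNorm_le_c2Norm M _).trans hclose))⟩
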